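/- Let $a,b>0$ and let $E=\{x+iy\in\mathbb{C} : x^2/a^2+y^2/b^2\le 1\}$. Let $w=u+iv\in E$, and let $g_w$ be the Green function of the Laplacian on $E$ with singularity at $w$, i.e. the real-valued solution of $$\Delta g_w=\delta_w \ \text{ in the interior of } E,\qquad g_w=0 \ \text{ on } \partial E.$$ Here the equation is understood in the sense of distributions, that is, $g_w$ is locally integrable in the interior of $E$ and $\int_E g_w\,\Delta\varphi\,dA=\varphi(w)$ for every smooth function $\varphi$ with compact support in the interior of $E$, and the boundary values $0$ are attained continuously at every point of $\partial E$. Then $g_w$ is integrable on $E$ and $$\int_E g_w\,dA=\frac{(bu)^2+(av)^2-(ab)^2}{2(a^2+b^2)},$$ where $dA$ denotes area (Lebesgue) measure. -/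

import Mathlib

open MeasureTheory Topology
open scoped ContDiff Laplacian

/-- The closed elliptical region `x² / a² + y² / b² ≤ 1` in the plane `ℂ`, with `z = x + i y`. -/
def ellipticalRegion (a b : ℝ) : Set ℂ :=
  {z : ℂ | z.re ^ 2 / a ^ 2 + z.im ^ 2 / b ^ 2 ≤ 1}

/-- `g` is the Green function of the Laplacian on the open set `D` with singularity at `w`, that is,
it solves `Δ g = δ_w` in `D` and `g = 0` on `∂D`.
The equation is meant in the sense of distributions on `D`, and the boundary values are attained
continuously. The normalization is that of `Δ g = + δ_w`, so that `g ≤ 0`; on the unit disk with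
`w = 0` the Green function is `(2π)⁻¹ log |z|`. -/
structure IsLaplaceGreenFunction (D : Set ℂ) (w : ℂ) (g : ℂ → ℝ) : Prop where
  /-- `g` is a (regular) distribution on `D`. -/
  locallyIntegrableOn : LocallyIntegrableOn g D volume
  /-- `Δ g = δ_w` in `D`, tested against all `φ ∈ C_c^∞(D)`. -/
  laplacian_eq_dirac : ∀ φ : ℂ → ℝ, ContDiff ℝ ∞ φ → HasCompactSupport φ → tsupport φ ⊆ D →
    ∫ z in D, g z * Δ φ z = φ w
  /-- `g = 0` on `∂D`. -/
  eq_zero_on_frontier : ∀ ζ ∈ frontier D, g ζ = 0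
  /-- `g` is continuous up to the boundary at every boundary point. -/
  continuousWithinAt_frontier : ∀ ζ ∈ frontier D, ContinuousWithinAt g (closure D) ζ

open Filter Set Pointwise InnerProductSpace

/-! Write q for the defining polynomial. Its Laplacian is the constant 2/a² + 2/b² and it vanishes
on the boundary, so formally ∫ g · Δq = q(w), which is the claim. Since q is not compactly supported
in the interior, the equation is tested against ε s(q/ε), with s = `smoothTruncation`. By the chain
rule (`laplacian_comp_ellipseDefiningFun`) its Laplacian is s'(q/ε) Δq + ε⁻¹ s''(q/ε) |∇q|².

As ε → 0 the first term gives ∫ g · Δq by dominated convergence. The second lives on a strip of area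
O(ε) along the boundary, which offsets ε⁻¹; it tends to 0 because g is uniformly small there
(`exists_abs_lt_of_near_boundary`). No control of ∇g is needed. -/

/-- The quadratic polynomial `x² / a² + y² / b² - 1`, which is negative inside the ellipse. -/
noncomputable def ellipseDefiningFun (a b : ℝ) (z : ℂ) : ℝ :=
  z.re ^ 2 / a ^ 2 + z.im ^ 2 / b ^ 2 - 1

/-- A smooth function equal to `s` for `s ≤ -2` and to `0` for `-1 ≤ s`. -/
noncomputable def smoothTruncation (s : ℝ) : ℝ := s * Real.smoothTransition (-s - 1)

/-! ### Derivatives of the truncation and their bounds. -/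

namespace smoothTruncation

theorem contDiff : ContDiff ℝ ∞ smoothTruncation :=
  contDiff_id.mul (Real.smoothTransition.contDiff.comp (contDiff_id.neg.sub contDiff_const))

theorem eq_self {s : ℝ} (hs : s ≤ -2) : smoothTruncation s = s := by
  rw [smoothTruncation, Real.smoothTransition.one_of_one_le (by linarith), mul_one]

theorem eq_zero {s : ℝ} (hs : -1 ≤ s) : smoothTruncation s = 0 := by
  rw [smoothTruncation, Real.smoothTransition.zero_of_nonpos (by linarith), mul_zero]

theorem contDiff_deriv : ContDiff ℝ ∞ (deriv smoothTruncation) :=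
  (contDiff_infty_iff_deriv.1 contDiff).2

theorem hasDerivAt (s : ℝ) : HasDerivAt smoothTruncation (deriv smoothTruncation s) s :=
  (contDiff.differentiable (by simp) s).hasDerivAt

theorem hasDerivAt_deriv (s : ℝ) :
    HasDerivAt (deriv smoothTruncation) (deriv (deriv smoothTruncation) s) s :=
  (contDiff_deriv.differentiable (by simp) s).hasDerivAt

theorem continuous_deriv_deriv : Continuous (deriv (deriv smoothTruncation)) :=
  (contDiff_infty_iff_deriv.1 contDiff_deriv).2.continuous

theorem deriv_eq_one {s : ℝ} (hs : s < -2) : deriv smoothTruncation s = 1 := by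
  have h : smoothTruncation =ᶠ[𝓝 s] id := by
    filter_upwards [Iio_mem_nhds hs] with t ht using eq_self ht.le
  rw [h.deriv_eq, deriv_id]

theorem deriv_eq_zero {s : ℝ} (hs : -1 < s) : deriv smoothTruncation s = 0 := by
  have h : smoothTruncation =ᶠ[𝓝 s] fun _ => 0 := by
    filter_upwards [Ioi_mem_nhds hs] with t ht using eq_zero (le_of_lt ht)
  rw [h.deriv_eq, deriv_const]

theorem deriv_deriv_eq_zero_of_lt {s : ℝ} (hs : s < -2) :
    deriv (deriv smoothTruncation) s = 0 := by
  have h : deriv smoothTruncation =ᶠ[𝓝 s] fun _ => 1 := by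
    filter_upwards [Iio_mem_nhds hs] with t ht using deriv_eq_one ht
  rw [h.deriv_eq, deriv_const]

theorem deriv_deriv_eq_zero_of_gt {s : ℝ} (hs : -1 < s) :
    deriv (deriv smoothTruncation) s = 0 := by
  have h : deriv smoothTruncation =ᶠ[𝓝 s] fun _ => 0 := by
    filter_upwards [Ioi_mem_nhds hs] with t ht using deriv_eq_zero ht
  rw [h.deriv_eq, deriv_const]

theorem exists_bound_deriv : ∃ C, ∀ s, |deriv smoothTruncation s| ≤ C := by
  obtain ⟨C, hC⟩ := (isCompact_Icc (a := (-2 : ℝ)) (b := -1)).exists_bound_of_continuousOn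
    contDiff_deriv.continuous.continuousOn
  refine ⟨max C 1, fun s => ?_⟩
  rcases lt_or_ge s (-2) with h | h
  · simp [deriv_eq_one h]
  rcases lt_or_ge (-1) s with h' | h'
  · simp [deriv_eq_zero h']
  · exact (hC s ⟨h, h'⟩).trans (le_max_left _ _)

theorem exists_bound_deriv_deriv : ∃ C, ∀ s, |deriv (deriv smoothTruncation) s| ≤ C := by
  obtain ⟨C, hC⟩ := (isCompact_Icc (a := (-2 : ℝ)) (b := -1)).exists_bound_of_continuousOn
    continuous_deriv_deriv.continuousOn
  refine ⟨max C 0, fun s => ?_⟩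
  rcases lt_or_ge s (-2) with h | h
  · simp [deriv_deriv_eq_zero_of_lt h]
  rcases lt_or_ge (-1) s with h' | h'
  · simp [deriv_deriv_eq_zero_of_gt h']
  · exact (hC s ⟨h, h'⟩).trans (le_max_left _ _)

end smoothTruncation

/-! ### Calculus, topology and area of the ellipse through q. -/

section Ellipse

variable {a b : ℝ}

theorem contDiff_ellipseDefiningFun : ContDiff ℝ ∞ (ellipseDefiningFun a b) :=
  (((Complex.reCLM.contDiff.pow 2).div_const _).add
    ((Complex.imCLM.contDiff.pow 2).div_const _)).sub contDiff_const

theorem continuous_ellipseDefiningFun : Continuous (ellipseDefiningFun a b) :=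
  contDiff_ellipseDefiningFun.continuous

theorem mem_ellipticalRegion_iff {z : ℂ} :
    z ∈ ellipticalRegion a b ↔ ellipseDefiningFun a b z ≤ 0 := by
  simp [ellipticalRegion, ellipseDefiningFun]

theorem ellipseDefiningFun_smul (t : ℝ) (z : ℂ) :
    ellipseDefiningFun a b (t • z) = t ^ 2 * (ellipseDefiningFun a b z + 1) - 1 := by
  simp only [ellipseDefiningFun, Complex.real_smul, Complex.re_ofReal_mul, Complex.im_ofReal_mul]
  ring

theorem hasFDerivAt_ellipseDefiningFun (z : ℂ) :
    HasFDerivAt (ellipseDefiningFun a b)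
      ((2 * z.re / a ^ 2) • Complex.reCLM + (2 * z.im / b ^ 2) • Complex.imCLM) z := by
  have h1 : HasFDerivAt (fun z : ℂ => z.re) Complex.reCLM z := Complex.reCLM.hasFDerivAt
  have h2 : HasFDerivAt (fun z : ℂ => z.im) Complex.imCLM z := Complex.imCLM.hasFDerivAt
  have h := (((h1.pow 2).mul_const (a ^ 2)⁻¹).add ((h2.pow 2).mul_const (b ^ 2)⁻¹)).sub_const 1
  have hf : ellipseDefiningFun a b = fun z => z.re ^ 2 * (a ^ 2)⁻¹ + z.im ^ 2 * (b ^ 2)⁻¹ - 1 := by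
    funext z
    simp only [ellipseDefiningFun, div_eq_mul_inv]
  rw [hf]
  refine HasFDerivAt.congr_fderiv h ?_
  ext v
  simp
  ring

/-- Chain rule for the Laplacian of a function of the defining polynomial of an ellipse. -/
theorem laplacian_comp_ellipseDefiningFun {h h' h'' : ℝ → ℝ} (hh : ∀ t, HasDerivAt h (h' t) t)
    (hh' : ∀ t, HasDerivAt h' (h'' t) t) (z : ℂ) :
    Δ (fun z => h (ellipseDefiningFun a b z)) z =
      h' (ellipseDefiningFun a b z) * (2 / a ^ 2 + 2 / b ^ 2) +
        h'' (ellipseDefiningFun a b z) * ((2 * z.re / a ^ 2) ^ 2 + (2 * z.im / b ^ 2) ^ 2) := by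
  -- Scalar functions times constant functionals: the form to which the product rule applies for the
  -- second derivative.
  have e1 : fderiv ℝ (fun z => h (ellipseDefiningFun a b z)) = fun z =>
      h' (ellipseDefiningFun a b z) •
        (z.re • (2 / a ^ 2) • Complex.reCLM + z.im • (2 / b ^ 2) • Complex.imCLM) := by
    funext z
    refine ((hh _).comp_hasFDerivAt z (hasFDerivAt_ellipseDefiningFun z)).fderiv.trans ?_
    ext v
    simp
    ring
  have h1 : HasFDerivAt (fun z : ℂ => z.re) Complex.reCLM z := Complex.reCLM.hasFDerivAt
  have h2 : HasFDerivAt (fun z : ℂ => z.im) Complex.imCLM z := Complex.imCLM.hasFDerivAt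
  have e2 := ((hh' _).comp_hasFDerivAt z (hasFDerivAt_ellipseDefiningFun (a := a) (b := b) z)).smul
    ((h1.smul_const ((2 / a ^ 2) • Complex.reCLM)).add
      (h2.smul_const ((2 / b ^ 2) • Complex.imCLM)))
  have e3 := e2.fderiv
  rw [laplacian_eq_iteratedFDeriv_complexPlane]
  simp only [iteratedFDeriv_two_apply, e1]
  erw [e3]
  simp
  ring

theorem ellipseDefiningFun_zero : ellipseDefiningFun a b 0 = -1 := by
  simp [ellipseDefiningFun]

theorem isClosed_ellipticalRegion : IsClosed (ellipticalRegion a b) := by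
  have : ellipticalRegion a b = {z | ellipseDefiningFun a b z ≤ 0} :=
    Set.ext fun _ => mem_ellipticalRegion_iff
  rw [this]
  exact isClosed_le continuous_ellipseDefiningFun continuous_const

theorem isCompact_ellipticalRegion (ha : 0 < a) (hb : 0 < b) :
    IsCompact (ellipticalRegion a b) := by
  refine (isCompact_closedBall (0 : ℂ) (a + b)).of_isClosed_subset isClosed_ellipticalRegion ?_
  intro z hz
  have hz' : z.re ^ 2 / a ^ 2 + z.im ^ 2 / b ^ 2 ≤ 1 := hz
  have h1 : 0 ≤ z.re ^ 2 / a ^ 2 := by positivity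
  have h2 : 0 ≤ z.im ^ 2 / b ^ 2 := by positivity
  have h3 : |z.re| ≤ a := abs_le_of_sq_le_sq ((div_le_one (by positivity)).1 (by linarith)) ha.le
  have h4 : |z.im| ≤ b := abs_le_of_sq_le_sq ((div_le_one (by positivity)).1 (by linarith)) hb.le
  rw [mem_closedBall_zero_iff]
  exact (Complex.norm_le_abs_re_add_abs_im z).trans (add_le_add h3 h4)

theorem interior_ellipticalRegion :
    interior (ellipticalRegion a b) = {z | ellipseDefiningFun a b z < 0} := by
  apply Set.Subset.antisymm
  · intro z hz
    -- Dilating slightly outward stays in the region, but would make q positive if q(z) ≥ 0.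
    have hc : Tendsto (fun t : ℝ => t • z) (𝓝[>] 1) (𝓝 z) := by
      have : Continuous fun t : ℝ => t • z := by fun_prop
      simpa using (this.tendsto 1).mono_left nhdsWithin_le_nhds
    obtain ⟨t, ht, ht1⟩ :=
      ((hc.eventually (mem_interior_iff_mem_nhds.1 hz)).and self_mem_nhdsWithin).exists
    have ht' := mem_ellipticalRegion_iff.1 ht
    rw [ellipseDefiningFun_smul] at ht'
    have ht1 : 1 < t := ht1
    by_contra! hcon
    simp only [Set.mem_ofPred_eq, not_lt] at hcon
    nlinarith
  · refine interior_maximal (fun z hz => mem_ellipticalRegion_iff.2 (le_of_lt hz)) ?_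
    exact isOpen_lt continuous_ellipseDefiningFun continuous_const

theorem closure_interior_ellipticalRegion :
    closure (interior (ellipticalRegion a b)) = ellipticalRegion a b := by
  refine (closure_minimal interior_subset isClosed_ellipticalRegion).antisymm fun z hz => ?_
  have hc : Tendsto (fun t : ℝ => t • z) (𝓝[Ioo 0 1] 1) (𝓝 z) := by
    have : Continuous fun t : ℝ => t • z := by fun_prop
    simpa using (this.tendsto 1).mono_left nhdsWithin_le_nhds
  have : (𝓝[Ioo (0 : ℝ) 1] 1).NeBot := right_nhdsWithin_Ioo_neBot zero_lt_one
  refine mem_closure_of_tendsto hc ?_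
  filter_upwards [self_mem_nhdsWithin] with t ht
  rw [interior_ellipticalRegion, Set.mem_ofPred_eq, ellipseDefiningFun_smul]
  have hz' := mem_ellipticalRegion_iff.1 hz
  have : t ^ 2 < 1 := pow_lt_one₀ ht.1.le ht.2 two_ne_zero
  nlinarith [mul_le_mul_of_nonneg_left hz' (sq_nonneg t)]

theorem frontier_interior_ellipticalRegion :
    frontier (interior (ellipticalRegion a b)) = {z | ellipseDefiningFun a b z = 0} := by
  rw [frontier, closure_interior_ellipticalRegion, interior_interior, interior_ellipticalRegion]
  ext z
  simp only [Set.mem_sdiff, mem_ellipticalRegion_iff, Set.mem_ofPred_eq, not_lt]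
  exact ⟨fun h => le_antisymm h.1 h.2, fun h => ⟨h.le, h.ge⟩⟩

/-- The sublevel sets of the defining polynomial are dilations of the ellipse. -/
theorem volume_ellipseDefiningFun_le {t : ℝ} (ht : -1 < t) :
    volume {z | ellipseDefiningFun a b z ≤ t} =
      ENNReal.ofReal (1 + t) * volume (ellipticalRegion a b) := by
  have hs : 0 < Real.sqrt (1 + t) := Real.sqrt_pos.2 (by linarith)
  have hs2 : Real.sqrt (1 + t) ^ 2 = 1 + t := Real.sq_sqrt (by linarith)
  have : {z | ellipseDefiningFun a b z ≤ t} = Real.sqrt (1 + t) • ellipticalRegion a b := by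
    ext z
    rw [Set.mem_smul_set_iff_inv_smul_mem₀ hs.ne', mem_ellipticalRegion_iff,
      ellipseDefiningFun_smul, inv_pow, hs2, Set.mem_ofPred_eq, sub_nonpos,
      inv_mul_le_one₀ (by linarith)]
    constructor <;> intro h <;> linarith
  rw [this, Measure.addHaar_smul, Complex.finrank_real_complex, hs2,
    abs_of_pos (by linarith)]

/-- Supplies the O(ε) area that cancels the factor ε⁻¹ of the second-derivative term. -/
theorem volume_real_strip (ha : 0 < a) (hb : 0 < b) {s t : ℝ} (hs : -1 < s) (hst : s ≤ t) :
    volume.real {z | s < ellipseDefiningFun a b z ∧ ellipseDefiningFun a b z ≤ t} =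
      (t - s) * volume.real (ellipticalRegion a b) := by
  have hd : {z | s < ellipseDefiningFun a b z ∧ ellipseDefiningFun a b z ≤ t} =
      {z | ellipseDefiningFun a b z ≤ t} \ {z | ellipseDefiningFun a b z ≤ s} := by
    ext z; simp [and_comm]
  have hm : MeasurableSet {z | ellipseDefiningFun a b z ≤ s} :=
    (isClosed_le continuous_ellipseDefiningFun continuous_const).measurableSet
  have hfin : volume {z | ellipseDefiningFun a b z ≤ t} ≠ ⊤ := by
    rw [volume_ellipseDefiningFun_le (by linarith)]
    exact ENNReal.mul_ne_top ENNReal.ofReal_ne_top (isCompact_ellipticalRegion ha hb).measure_lt_top.ne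
  rw [hd, measureReal_sdiff (Set.ofPred_subset_ofPred.2 fun z hz => le_trans hz hst) hm hfin]
  simp only [Measure.real, volume_ellipseDefiningFun_le hs,
    volume_ellipseDefiningFun_le (hs.trans_le hst), ENNReal.toReal_mul,
    ENNReal.toReal_ofReal (show 0 ≤ 1 + s by linarith),
    ENNReal.toReal_ofReal (show 0 ≤ 1 + t by linarith)]
  ring

end Ellipse

/-! ### Testing the equation and passing to the limit. -/

namespace IsLaplaceGreenFunction

variable {a b : ℝ} {w : ℂ} {g : ℂ → ℝ}

/-- The Green function is uniformly small near the boundary. -/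
theorem exists_abs_lt_of_near_boundary (ha : 0 < a) (hb : 0 < b)
    (hg : IsLaplaceGreenFunction (interior (ellipticalRegion a b)) w g) {η : ℝ} (hη : 0 < η) :
    ∃ δ > 0, ∀ z ∈ ellipticalRegion a b, -δ < ellipseDefiningFun a b z → |g z| < η := by
  have hU : {z | z ∈ ellipticalRegion a b → |g z| < η} ∈
      𝓝ˢ (frontier (interior (ellipticalRegion a b))) := by
    rw [mem_nhdsSet_iff_forall]
    intro ζ hζ
    have h := (hg.continuousWithinAt_frontier ζ hζ).abs
    rw [closure_interior_ellipticalRegion] at h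
    have h0 : |g ζ| < η := by simpa [hg.eq_zero_on_frontier ζ hζ] using hη
    exact mem_nhdsWithin_iff_eventually.1 (h.eventually (gt_mem_nhds h0))
  obtain ⟨V, hVo, hV, hVU⟩ := mem_nhdsSet_iff_exists.1 hU
  -- Off the neighbourhood `V` of the boundary, q attains a negative maximum, which yields δ.
  have hK : IsCompact (ellipticalRegion a b \ V) := (isCompact_ellipticalRegion ha hb).diff hVo
  have hneg : ∀ z ∈ ellipticalRegion a b \ V, ellipseDefiningFun a b z < 0 := fun z hz =>
    lt_of_le_of_ne (mem_ellipticalRegion_iff.1 hz.1) fun h0 =>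
      hz.2 (hV (by rwa [frontier_interior_ellipticalRegion]))
  obtain hemp | hne := (ellipticalRegion a b \ V).eq_empty_or_nonempty
  · exact ⟨1, one_pos, fun z hz _ => hVU (Set.sdiff_eq_empty.1 hemp hz) hz⟩
  · obtain ⟨z₀, hz₀, hmax⟩ :=
      hK.exists_isMaxOn hne continuous_ellipseDefiningFun.continuousOn
    refine ⟨-ellipseDefiningFun a b z₀, neg_pos.2 (hneg z₀ hz₀), fun z hz hlt => ?_⟩
    by_cases hzV : z ∈ V
    · exact hVU hzV hz
    · have : ellipseDefiningFun a b z ≤ ellipseDefiningFun a b z₀ := hmax ⟨hz, hzV⟩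
      linarith

/-- Local integrability handles the compact part q ≤ -δ; on the rest the boundary values force |g| <
1. -/
theorem integrableOn_interior (ha : 0 < a) (hb : 0 < b)
    (hg : IsLaplaceGreenFunction (interior (ellipticalRegion a b)) w g) :
    IntegrableOn g (interior (ellipticalRegion a b)) volume := by
  obtain ⟨δ, hδ, hsmall⟩ := hg.exists_abs_lt_of_near_boundary ha hb one_pos
  have hE := isCompact_ellipticalRegion ha hb
  have hclosed : IsClosed {z | ellipseDefiningFun a b z ≤ -δ} :=
    isClosed_le continuous_ellipseDefiningFun continuous_const
  have hinner : IntegrableOn g {z | ellipseDefiningFun a b z ≤ -δ} volume := by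
    have hsub : {z | ellipseDefiningFun a b z ≤ -δ} ⊆ interior (ellipticalRegion a b) := by
      rw [interior_ellipticalRegion]
      intro z hz
      exact lt_of_le_of_lt hz (neg_lt_zero.2 hδ)
    exact hg.locallyIntegrableOn.integrableOn_compact_subset hsub
      (hE.of_isClosed_subset hclosed (hsub.trans interior_subset))
  have houter : IntegrableOn g
      (interior (ellipticalRegion a b) \ {z | ellipseDefiningFun a b z ≤ -δ}) volume := by
    refine IntegrableOn.of_bound
      ((measure_mono (sdiff_subset.trans interior_subset)).trans_lt hE.measure_lt_top)
      (hg.locallyIntegrableOn.aestronglyMeasurable.mono_set sdiff_subset) 1 ?_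
    refine ae_restrict_of_forall_mem (isOpen_interior.measurableSet.diff hclosed.measurableSet) ?_
    intro z hz
    exact (hsmall z (interior_subset hz.1) (not_le.1 hz.2)).le
  exact (hinner.union houter).mono_set fun z hz => by
    by_cases h : ellipseDefiningFun a b z ≤ -δ
    · exact Or.inl h
    · exact Or.inr ⟨hz, h⟩

/-- The equation `Δ g = δ_w` tested against a smooth truncation of the defining polynomial. -/
theorem integral_truncation (ha : 0 < a) (hb : 0 < b)
    (hg : IsLaplaceGreenFunction (interior (ellipticalRegion a b)) w g) {ε : ℝ} (hε : 0 < ε) :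
    (∫ z in interior (ellipticalRegion a b), g z *
        (deriv smoothTruncation (ε⁻¹ * ellipseDefiningFun a b z) * (2 / a ^ 2 + 2 / b ^ 2))) +
      (∫ z in interior (ellipticalRegion a b), g z *
        (ε⁻¹ * deriv (deriv smoothTruncation) (ε⁻¹ * ellipseDefiningFun a b z) *
          ((2 * z.re / a ^ 2) ^ 2 + (2 * z.im / b ^ 2) ^ 2))) =
      ε * smoothTruncation (ε⁻¹ * ellipseDefiningFun a b w) := by
  have hE := isCompact_ellipticalRegion ha hb
  have hclosed : IsClosed {z | ellipseDefiningFun a b z ≤ -ε} :=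
    isClosed_le continuous_ellipseDefiningFun continuous_const
  have hsub : {z | ellipseDefiningFun a b z ≤ -ε} ⊆ interior (ellipticalRegion a b) := by
    rw [interior_ellipticalRegion]
    intro z hz
    exact lt_of_le_of_lt hz (neg_lt_zero.2 hε)
  have hts : tsupport (fun z => ε * smoothTruncation (ε⁻¹ * ellipseDefiningFun a b z)) ⊆
      {z | ellipseDefiningFun a b z ≤ -ε} := by
    refine closure_minimal (fun z hz => ?_) hclosed
    by_contra hcon
    simp only [Set.mem_ofPred_eq, not_le] at hcon
    refine hz ?_
    have : -1 ≤ ε⁻¹ * ellipseDefiningFun a b z := by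
      rw [le_inv_mul_iff₀ hε]; linarith
    simp only [smoothTruncation.eq_zero this, mul_zero]
  have hsmooth : ContDiff ℝ ∞
      (fun z => ε * smoothTruncation (ε⁻¹ * ellipseDefiningFun a b z)) :=
    contDiff_const.mul (smoothTruncation.contDiff.comp
      (contDiff_const.mul contDiff_ellipseDefiningFun))
  have key := hg.laplacian_eq_dirac _ hsmooth
    (hE.of_isClosed_subset (isClosed_tsupport _) (hts.trans (hsub.trans interior_subset)))
    (hts.trans hsub)
  rw [← key, ← integral_add]
  · congr 1 with z
    have h1 (t : ℝ) : HasDerivAt (fun t => ε * smoothTruncation (ε⁻¹ * t))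
        (deriv smoothTruncation (ε⁻¹ * t)) t := by
      have := ((smoothTruncation.hasDerivAt (ε⁻¹ * t)).comp t
        ((hasDerivAt_id t).const_mul ε⁻¹)).const_mul ε
      refine HasDerivAt.congr_deriv this ?_
      field_simp
    have h2 (t : ℝ) : HasDerivAt (fun t => deriv smoothTruncation (ε⁻¹ * t))
        (ε⁻¹ * deriv (deriv smoothTruncation) (ε⁻¹ * t)) t := by
      have := (smoothTruncation.hasDerivAt_deriv (ε⁻¹ * t)).comp t
        ((hasDerivAt_id t).const_mul ε⁻¹)
      refine HasDerivAt.congr_deriv this ?_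
      ring
    rw [laplacian_comp_ellipseDefiningFun h1 h2]
    ring
  all_goals
    refine IntegrableOn.mul_continuousOn_of_subset (hg.integrableOn_interior ha hb)
      (Continuous.continuousOn ?_) isOpen_interior.measurableSet hE interior_subset
    have hq := continuous_ellipseDefiningFun (a := a) (b := b)
    have hd := smoothTruncation.contDiff_deriv.continuous
    have hdd := smoothTruncation.continuous_deriv_deriv
    fun_prop

theorem tendsto_integral_deriv_truncation (ha : 0 < a) (hb : 0 < b)
    (hg : IsLaplaceGreenFunction (interior (ellipticalRegion a b)) w g) :
    Tendsto (fun ε : ℝ => ∫ z in interior (ellipticalRegion a b), g z *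
      (deriv smoothTruncation (ε⁻¹ * ellipseDefiningFun a b z) * (2 / a ^ 2 + 2 / b ^ 2)))
      (𝓝[>] 0)
      (𝓝 (∫ z in interior (ellipticalRegion a b), g z * (1 * (2 / a ^ 2 + 2 / b ^ 2)))) := by
  obtain ⟨C, hC⟩ := smoothTruncation.exists_bound_deriv
  have hgi := hg.integrableOn_interior ha hb
  refine tendsto_integral_filter_of_dominated_convergence
    (fun z => |g z| * (C * (2 / a ^ 2 + 2 / b ^ 2))) ?_ ?_ (hgi.abs.mul_const _) ?_
  · refine Eventually.of_forall fun ε => hgi.aestronglyMeasurable.mul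
      (Continuous.aestronglyMeasurable ?_)
    have hq := continuous_ellipseDefiningFun (a := a) (b := b)
    have hd := smoothTruncation.contDiff_deriv.continuous
    fun_prop
  · refine Eventually.of_forall fun ε => Eventually.of_forall fun z => ?_
    have h0 : 0 ≤ 2 / a ^ 2 + 2 / b ^ 2 := by positivity
    rw [Real.norm_eq_abs, abs_mul, abs_mul, abs_of_nonneg h0]
    gcongr
    exact hC _
  · refine ae_restrict_of_forall_mem isOpen_interior.measurableSet fun z hz => ?_
    rw [interior_ellipticalRegion, Set.mem_ofPred_eq] at hz
    refine tendsto_const_nhds.congr' ?_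
    have hlt : ∀ᶠ ε : ℝ in 𝓝[>] 0, ε < -ellipseDefiningFun a b z / 2 :=
      nhdsWithin_le_nhds (gt_mem_nhds (by linarith))
    filter_upwards [hlt, self_mem_nhdsWithin] with ε h1 h2
    have h2 : 0 < ε := h2
    rw [smoothTruncation.deriv_eq_one]
    rw [inv_mul_lt_iff₀ h2]
    linarith

theorem tendsto_integral_deriv_deriv_truncation (ha : 0 < a) (hb : 0 < b)
    (hg : IsLaplaceGreenFunction (interior (ellipticalRegion a b)) w g) :
    Tendsto (fun ε : ℝ => ∫ z in interior (ellipticalRegion a b), g z *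
      (ε⁻¹ * deriv (deriv smoothTruncation) (ε⁻¹ * ellipseDefiningFun a b z) *
        ((2 * z.re / a ^ 2) ^ 2 + (2 * z.im / b ^ 2) ^ 2))) (𝓝[>] 0) (𝓝 0) := by
  obtain ⟨C, hC⟩ := smoothTruncation.exists_bound_deriv_deriv
  have hC0 : 0 ≤ C := (abs_nonneg _).trans (hC 0)
  have hE := isCompact_ellipticalRegion ha hb
  have hcont : Continuous fun z : ℂ => (2 * z.re / a ^ 2) ^ 2 + (2 * z.im / b ^ 2) ^ 2 := by
    fun_prop
  obtain ⟨M, hM⟩ := hE.exists_bound_of_continuousOn hcont.continuousOn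
  have hM0 : 0 ≤ M := (norm_nonneg _).trans
    (hM 0 (mem_ellipticalRegion_iff.2 (by rw [ellipseDefiningFun_zero]; norm_num)))
  set A := volume.real (ellipticalRegion a b) with hA
  have hA0 : 0 ≤ A := measureReal_nonneg
  rw [Metric.tendsto_nhds]
  intro r hr
  -- C, M, A bound |s''|, |∇q|² and the area; 2εA will be the area of the strip.
  obtain ⟨η, hη, hηr⟩ : ∃ η > 0, η * (C * M * (2 * A)) < r := by
    refine ⟨r / (C * M * (2 * A) + 1), by positivity, ?_⟩
    rw [div_mul_eq_mul_div, div_lt_iff₀ (by positivity)]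
    linarith
  obtain ⟨δ, hδ, hsmall⟩ := hg.exists_abs_lt_of_near_boundary ha hb hη
  have hlt : ∀ᶠ ε : ℝ in 𝓝[>] 0, ε < min (δ / 3) (1 / 3) :=
    nhdsWithin_le_nhds (gt_mem_nhds (by positivity))
  filter_upwards [hlt, self_mem_nhdsWithin] with ε h1 h2
  have hε : 0 < ε := h2
  have hεδ : 3 * ε < δ := by linarith [h1.trans_le (min_le_left _ _)]
  have hε1 : 3 * ε < 1 := by linarith [h1.trans_le (min_le_right _ _)]
  -- The integrand is supported in -2ε ≤ q ≤ -ε; the margin down to -3ε absorbs the strict lower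
  -- inequality.
  set S := {z | -(3 * ε) < ellipseDefiningFun a b z ∧ ellipseDefiningFun a b z ≤ -ε} with hS
  have hSD : S ⊆ interior (ellipticalRegion a b) := by
    rw [interior_ellipticalRegion]
    rintro z ⟨-, hz⟩
    exact lt_of_le_of_lt hz (neg_lt_zero.2 hε)
  have hvol : volume.real S = 2 * ε * A := by
    rw [hS, volume_real_strip ha hb (by linarith) (by linarith)]
    ring
  rw [dist_zero_right, setIntegral_eq_of_subset_of_forall_sdiff_eq_zero
    isOpen_interior.measurableSet hSD ?_]
  · refine (norm_setIntegral_le_of_norm_le_const (C := η * (ε⁻¹ * C * M))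
      ((measure_mono (hSD.trans interior_subset)).trans_lt hE.measure_lt_top) ?_).trans_lt ?_
    · intro z hz
      have hzE := interior_subset (hSD hz)
      rw [norm_mul, norm_mul, norm_mul, Real.norm_of_nonneg (inv_nonneg.2 hε.le)]
      gcongr
      · exact (hsmall z hzE (by linarith [hz.1])).le
      · exact hC _
      · exact hM z hzE
    · rw [hvol]
      calc η * (ε⁻¹ * C * M) * (2 * ε * A) = η * (C * M * (2 * A)) := by field_simp
        _ < r := hηr
  · rintro z ⟨-, hz⟩
    have : deriv (deriv smoothTruncation) (ε⁻¹ * ellipseDefiningFun a b z) = 0 := by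
      rcases le_or_gt (ellipseDefiningFun a b z) (-(3 * ε)) with h | h
      · refine smoothTruncation.deriv_deriv_eq_zero_of_lt ?_
        rw [inv_mul_lt_iff₀ hε]
        linarith
      · refine smoothTruncation.deriv_deriv_eq_zero_of_gt ?_
        rw [lt_inv_mul_iff₀ hε]
        by_contra! hcon
        exact hz ⟨h, by linarith⟩
    simp [this]

/-- The case q = 0 covers w on the boundary. -/
theorem tendsto_truncation_apply {q : ℝ} (hq : q ≤ 0) :
    Tendsto (fun ε : ℝ => ε * smoothTruncation (ε⁻¹ * q)) (𝓝[>] 0) (𝓝 q) := by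
  refine tendsto_const_nhds.congr' ?_
  rcases hq.eq_or_lt with rfl | hq
  · exact Eventually.of_forall fun ε => by simp [smoothTruncation]
  · have hlt : ∀ᶠ ε : ℝ in 𝓝[>] 0, ε < -q / 2 :=
      nhdsWithin_le_nhds (gt_mem_nhds (by linarith))
    filter_upwards [hlt, self_mem_nhdsWithin] with ε h1 h2
    have h2 : 0 < ε := h2
    rw [smoothTruncation.eq_self, mul_inv_cancel_left₀ h2.ne']
    rw [inv_mul_le_iff₀ h2]
    linarith

theorem integral_interior (ha : 0 < a) (hb : 0 < b) (hw : w ∈ ellipticalRegion a b)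
    (hg : IsLaplaceGreenFunction (interior (ellipticalRegion a b)) w g) :
    (∫ z in interior (ellipticalRegion a b), g z) * (2 / a ^ 2 + 2 / b ^ 2) =
      ellipseDefiningFun a b w := by
  have h := (hg.tendsto_integral_deriv_truncation ha hb).add
    (hg.tendsto_integral_deriv_deriv_truncation ha hb)
  rw [add_zero, integral_mul_const, one_mul] at h
  refine tendsto_nhds_unique (h.congr' ?_)
    (tendsto_truncation_apply (mem_ellipticalRegion_iff.1 hw))
  filter_upwards [self_mem_nhdsWithin] with ε hε using hg.integral_truncation ha hb hε

end IsLaplaceGreenFunction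

theorem mainTheorem9 (a b : ℝ) (ha : 0 < a) (hb : 0 < b) (w : ℂ) (hw : w ∈ ellipticalRegion a b)
    (g : ℂ → ℝ) (hg : IsLaplaceGreenFunction (interior (ellipticalRegion a b)) w g) :
    IntegrableOn g (ellipticalRegion a b) volume ∧
      ∫ z in ellipticalRegion a b, g z =
        ((b * w.re) ^ 2 + (a * w.im) ^ 2 - (a * b) ^ 2) / (2 * (a ^ 2 + b ^ 2)) := by
  -- As g vanishes on the boundary, passing to the closed region needs no null-set argument.
  have hzero : ∀ z ∈ ellipticalRegion a b \ interior (ellipticalRegion a b), g z = 0 := by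
    intro z hz
    refine hg.eq_zero_on_frontier z ?_
    rw [frontier, closure_interior_ellipticalRegion, interior_interior]
    exact hz
  have hmeas : MeasurableSet (ellipticalRegion a b) := isClosed_ellipticalRegion.measurableSet
  refine ⟨(hg.integrableOn_interior ha hb).of_forall_sdiff_eq_zero hmeas hzero, ?_⟩
  rw [setIntegral_eq_of_subset_of_forall_sdiff_eq_zero hmeas interior_subset hzero]
  have h := hg.integral_interior ha hb hw
  rw [ellipseDefiningFun] at h
  rw [eq_div_iff (by positivity)]
  field_simp at h
  linear_combination h
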